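/- Let $K$ be a field, $S=K[x_1,\dots,x_n]$, and let $\alpha=(k_1,\dots,k_n)$ be a vector of positive integers. Put $S^\alpha=K[x_{ij} : 1\le i\le n,\ 1\le j\le k_i]$ and $P_i=(x_{i1},\dots,x_{ik_i})\subset S^\alpha$. For a monomial $x^{\mathbf u}=x_1^{u_1}\cdots x_n^{u_n}$ let $(x^{\mathbf u})^\alpha=P_1^{u_1}\cdots P_n^{u_n}$, and for a finite set $\mathcal A$ of monomials of $S$ let $\mathcal A^\alpha=\bigcup_{x^{\mathbf u}\in\mathcal A}G\big((x^{\mathbf u})^\alpha\big)$, where $G(I)$ denotes the set of minimal monomial generators of a monomial ideal $I$. For a finite set $\mathcal B$ of monomials in a polynomial ring over $K$, the toric ideal $I_{\mathcal B}$ is the kernel of the $K$-algebra homomorphism $K[y_u : u\in\mathcal B]\to K[\mathcal B]$, $y_u\mapsto u$. A quadratic binomial is a difference of two distinct monomials of degree $2$ in the variables $y_u$. Then $I_{\mathcal A}$ has a Gröbner basis consisting of quadratic binomials, with respect to some term order on $K[y_u:u\in\mathcal A]$, if and only if $I_{\mathcal A^\alpha}$ has a Gröbner basis consisting of quadratic binomials,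 with respect to some term order on $K[y_u:u\in\mathcal A^\alpha]$. (The empty Gröbner basis of the zero ideal is allowed.) -/

import Mathlib

open MvPolynomial

universe u v

section Toric

variable (K : Type v) [Field K] {σ : Type u}

/-- A monomial in the variables `x_s`, `s ∈ σ`, is given by its exponent vector `σ →₀ ℕ`.
For a set `A` of monomials, this is the `K`-algebra homomorphism
`φ_A : S_A = K[y_u : u ∈ A] → K[x_s : s ∈ σ]`, `y_u ↦ x^u`, whose image is the toric ring `K[A]`. -/
noncomputable def toricHom (A : Set (σ →₀ ℕ)) : MvPolynomial A K →ₐ[K] MvPolynomial σ K :=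
  aeval fun u : A => monomial (u : σ →₀ ℕ) (1 : K)

/-- The toric ideal `I_A`, the kernel of `φ_A`. -/
noncomputable def toricIdeal (A : Set (σ →₀ ℕ)) : Ideal (MvPolynomial A K) :=
  RingHom.ker (toricHom K A)

end Toric

section Groebner

variable {K : Type v} [Field K] {τ : Type u}

/-- `G` is a Gröbner basis of the ideal `I` with respect to the term order `m`: a finite set of
nonzero elements of `I` whose leading terms generate the initial ideal of `I`. -/
def IsGroebnerBasis (m : MonomialOrder.{u, u} τ) (I : Ideal (MvPolynomial τ K))
    (G : Set (MvPolynomial τ K)) : Prop :=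
  G.Finite ∧ G ⊆ (I : Set (MvPolynomial τ K)) ∧ (0 : MvPolynomial τ K) ∉ G ∧
    Ideal.span (m.leadingTerm '' G) = Ideal.span (m.leadingTerm '' (I : Set (MvPolynomial τ K)))

/-- A difference of two distinct monomials of degree two. -/
def IsQuadraticBinomial (f : MvPolynomial τ K) : Prop :=
  f ≠ 0 ∧ ∃ a b c d : τ, f = X a * X b - X c * X d

/-- For some term order, `I` has a Gröbner basis consisting of quadratic binomials.
(The type carrying the term order may be taken in the universe of `τ`, because it is in bijection
with `τ →₀ ℕ`.) -/
def HasQuadraticGroebnerBasis (I : Ideal (MvPolynomial τ K)) : Prop :=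
  ∃ (m : MonomialOrder.{u, u} τ) (G : Set (MvPolynomial τ K)),
    IsGroebnerBasis m I G ∧ ∀ f ∈ G, IsQuadraticBinomial f

end Groebner

section Expansion

variable (K : Type v) [Field K] {n : ℕ} (α : Fin n → ℕ)

/-- The ideal `P_i = (x_{i1}, …, x_{ik_i})` of `S^α = K[x_{ij} : 1 ≤ i ≤ n, 1 ≤ j ≤ k_i]`,
where `α = (k_1, …, k_n)`. -/
noncomputable def blockIdeal (i : Fin n) : Ideal (MvPolynomial (Σ i, Fin (α i)) K) :=
  Ideal.span (Set.range fun j : Fin (α i) => X ⟨i, j⟩)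

/-- The expansion `(x^u)^α = P_1^{u(1)} ⋯ P_n^{u(n)}` of the principal ideal `(x^u)`. -/
noncomputable def expansionIdeal (u : Fin n →₀ ℕ) : Ideal (MvPolynomial (Σ i, Fin (α i)) K) :=
  ∏ i, blockIdeal K α i ^ u i

/-- `G(I)`: the monomials in `I` that are minimal with respect to divisibility. -/
def minimalMonomials {σ : Type u} (I : Ideal (MvPolynomial σ K)) : Set (σ →₀ ℕ) :=
  {w | Minimal (fun w' => monomial w' (1 : K) ∈ I) w}

/-- The expansion `A^α = ⋃_{x^u ∈ A} G((x^u)^α)` of a set `A` of monomials. -/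
def expansion (A : Set (Fin n →₀ ℕ)) : Set ((Σ i, Fin (α i)) →₀ ℕ) :=
  ⋃ u ∈ A, minimalMonomials K (expansionIdeal K α u)

/-- A monomial lies in `(x^u)^α` iff its degree in the `i`-th block of variables is at least
`u(i)`, for all `i`. -/
theorem monomial_mem_expansionIdeal (u : Fin n →₀ ℕ) (w : (Σ i, Fin (α i)) →₀ ℕ) :
    monomial w (1 : K) ∈ expansionIdeal K α u ↔ ∀ i, u i ≤ ∑ j, w ⟨i, j⟩ := by
  classical
  constructor
  · intro h i
    have key : ∀ k : ℕ, ∀ f ∈ blockIdeal K α i ^ k, ∀ d ∈ f.support,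
        k ≤ ∑ j, d ⟨i, j⟩ := by
      intro k
      induction k with
      | zero => intros; exact Nat.zero_le _
      | succ k ih =>
        intro f hf
        rw [pow_succ] at hf
        refine Submodule.mul_induction_on hf ?_ ?_
        · intro g hg p hp d hd
          obtain ⟨d₁, h₁, d₂, h₂, rfl⟩ := Finset.mem_add.1 (support_mul g p hd)
          have e₁ := ih g hg d₁ h₁
          have e₂ : 1 ≤ ∑ j, d₂ ⟨i, j⟩ := by
            rw [blockIdeal, Set.range_comp' (fun x => X x) (fun j : Fin (α i) => (⟨i, j⟩ : Σ i, Fin (α i))),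
              mem_ideal_span_X_image] at hp
            obtain ⟨_, ⟨j, rfl⟩, hj⟩ := hp d₂ h₂
            exact (Nat.one_le_iff_ne_zero.2 hj).trans
              (Finset.single_le_sum (f := fun j => d₂ ⟨i, j⟩) (fun _ _ => Nat.zero_le _)
                (Finset.mem_univ j))
          simp only [Finsupp.add_apply, Finset.sum_add_distrib]
          omega
        · intro f g hf hg d hd
          rcases Finset.mem_union.1 (support_add hd) with h | h
          exacts [hf d h, hg d h]
    have hle : expansionIdeal K α u ≤ blockIdeal K α i ^ u i :=
      Ideal.prod_le_inf.trans (Finset.inf_le (Finset.mem_univ i))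
    exact key _ _ (hle h) w (by simp)
  · intro h
    have hw : monomial w (1 : K) = ∏ i, ∏ j, X (⟨i, j⟩ : Σ i, Fin (α i)) ^ w ⟨i, j⟩ := by
      rw [monomial_eq, C_1, one_mul, Finsupp.prod_fintype _ _ (by simp), ← Finset.univ_sigma_univ,
        Finset.prod_sigma]
    rw [hw]
    unfold expansionIdeal
    refine Ideal.prod_mem_prod fun i _ => Ideal.pow_le_pow_right (h i) ?_
    have hX : ∀ j : Fin (α i), (X ⟨i, j⟩ : MvPolynomial (Σ i, Fin (α i)) K) ∈ blockIdeal K α i :=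
      fun j => Ideal.subset_span (Set.mem_range_self j)
    have hp := Ideal.prod_mem_prod (s := Finset.univ) (I := fun j => blockIdeal K α i ^ w ⟨i, j⟩)
      fun j _ => Ideal.pow_mem_pow (hX j) (w ⟨i, j⟩)
    rwa [Finset.prod_pow_eq_pow_sum] at hp

/-- `A^α` consists of the monomials which `x_{ij} ↦ x_i` maps into `A`. -/
theorem mem_expansion_iff (A : Set (Fin n →₀ ℕ)) (w : (Σ i, Fin (α i)) →₀ ℕ) :
    w ∈ expansion K α A ↔ ∃ u ∈ A, ∀ i, ∑ j, w ⟨i, j⟩ = u i := by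
  classical
  simp only [expansion, Set.mem_iUnion, exists_prop, minimalMonomials, Set.mem_ofPred_eq]
  refine exists_congr fun u => and_congr_right fun _ => ?_
  simp only [monomial_mem_expansionIdeal]
  constructor
  · rintro ⟨h, hmin⟩ i
    refine le_antisymm ?_ (h i)
    by_contra! hlt
    obtain ⟨j, -, hj⟩ : ∃ j ∈ Finset.univ, w ⟨i, j⟩ ≠ 0 :=
      Finset.exists_ne_zero_of_sum_ne_zero (by omega)
    have hle : Finsupp.single (⟨i, j⟩ : Σ i, Fin (α i)) 1 ≤ w := by
      rw [Finsupp.single_le_iff]; omega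
    obtain ⟨w', rfl⟩ := exists_add_of_le hle
    have := hmin (y := w') (fun i' => ?_) le_add_self ⟨i, j⟩
    · simp at this
    · have h' := h i'
      by_cases hi : i' = i
      · subst hi
        have e : ∑ x, (Finsupp.single (⟨i', j⟩ : Σ i, Fin (α i)) 1 : _ →₀ ℕ) ⟨i', x⟩ = 1 := by
          simp [Finsupp.single_apply]
        simp only [Finsupp.add_apply, Finset.sum_add_distrib, e] at hlt
        omega
      · have e : ∀ x, (Finsupp.single (⟨i, j⟩ : Σ i, Fin (α i)) 1 : _ →₀ ℕ) ⟨i', x⟩ = 0 := by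
          intro x
          rw [Finsupp.single_apply, if_neg]
          rintro ⟨⟩
          exact hi rfl
        simpa [e] using h'
  · intro h
    refine ⟨fun i => (h i).ge, fun w' h' hle => ?_⟩
    rintro ⟨i, j⟩
    have hs : ∑ j, w' ⟨i, j⟩ = ∑ j, w ⟨i, j⟩ :=
      le_antisymm (Finset.sum_le_sum fun j _ => hle ⟨i, j⟩) ((h i).trans_le (h' i))
    exact ((Finset.sum_eq_sum_iff_of_le fun j _ => hle ⟨i, j⟩).1 hs j (Finset.mem_univ j)).ge

end Expansion

/-! The toric ideal has a quadratic Gröbner basis exactly when, for some term order, each fibre of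
the toric degree map contains only one monomial that quadratic binomials cannot lower
(`hasQuadraticGroebnerBasis_toricIdeal_iff`). The theorem thus becomes a transfer of this uniqueness
between `A` and its expansion `B`, the preimage of `A` under `x_{ij} ↦ x_i`.

From `A` to `B`, compare monomials first by their images over `A`, then by a weight that rewards
spreading out a strictly convex function of a label `T`. Relations over `A` lift to `B`, so a
reduced monomial has reduced image, and this image is unique by hypothesis. Swapping two variables
of one block between two factors that are out of order lowers the weight, so a reduced monomial is
also sorted. A sorted monomial is recovered from its image and its toric degree by peeling off the
factor of least `T` (`IsSortedBy.eq_of_toricDegree_eq`).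

From `B` to `A`, embed `A` by `x_i ↦ x_{i0}`. This is a face: a product using only these variables
factors only through them, so restricting the order preserves reducedness. -/

/-- The term order on `τ` obtained by comparing the images of exponent vectors under an injective
monotone homomorphism to a well-ordered monoid. -/
noncomputable def MonomialOrder.ofInjective {τ M : Type u} [AddCommMonoid M]
    [LinearOrder M] [IsOrderedAddMonoid M] [WellFoundedLT M] (f : (τ →₀ ℕ) →+ M)
    (hf : Function.Injective f) (hmono : Monotone f) : MonomialOrder.{u, u} τ where
  syn := AddMonoidHom.mrange f
  addCommMonoidSyn := inferInstance
  linearOrderSyn := inferInstance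
  isOrderedAddMonoid_syn := inferInstance
  toSyn := AddEquiv.ofBijective f.mrangeRestrict
    ⟨fun _ _ h => hf (congrArg Subtype.val h), f.mrangeRestrict_surjective⟩
  toSyn_monotone := fun _ _ h => hmono h
  wellFoundedLT_syn := ⟨InvImage.wf Subtype.val (wellFounded_lt (α := M))⟩

theorem MonomialOrder.ofInjective_le_iff {τ M : Type u} [AddCommMonoid M]
    [LinearOrder M] [IsOrderedAddMonoid M] [WellFoundedLT M] (f : (τ →₀ ℕ) →+ M)
    (hf : Function.Injective f) (hmono : Monotone f) (a b : τ →₀ ℕ) :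
    (MonomialOrder.ofInjective f hf hmono).toSyn a ≤ (MonomialOrder.ofInjective f hf hmono).toSyn b
      ↔ f a ≤ f b := Iff.rfl

/-- Every finite set of variables has a term order. -/
theorem MonomialOrder.nonempty_of_finite (τ : Type u) [Finite τ] :
    Nonempty (MonomialOrder.{u, u} τ) := by
  obtain ⟨n, ⟨e⟩⟩ := Finite.exists_equiv_fin τ
  let : LinearOrder τ := LinearOrder.lift' e e.injective
  exact ⟨MonomialOrder.lex⟩

/-! ### Quadratic rewriting in the fibres of the toric map -/

section Rewriting

variable {σ τ : Type u}

/-- The exponent vector of the image of the monomial `y^a` under the toric homomorphism. -/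
noncomputable def toricDegree (A : Set (σ →₀ ℕ)) : (A →₀ ℕ) →+ (σ →₀ ℕ) :=
  (Finsupp.linearCombination ℕ (fun u : A => (u : σ →₀ ℕ))).toAddMonoidHom

theorem toricDegree_single (A : Set (σ →₀ ℕ)) (u : A) (k : ℕ) :
    toricDegree A (Finsupp.single u k) = k • (u : σ →₀ ℕ) := by
  simp [toricDegree]

/-- The exponent vector of `y_p y_q`. -/
noncomputable def pairExp (p q : τ) : τ →₀ ℕ := Finsupp.single p 1 + Finsupp.single q 1

theorem toricDegree_pairExp (A : Set (σ →₀ ℕ)) (p q : A) :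
    toricDegree A (pairExp p q) = (p : σ →₀ ℕ) + q := by
  simp [pairExp, toricDegree_single]

theorem mapDomain_pairExp {ρ : Type*} (f : τ → ρ) (p q : τ) :
    Finsupp.mapDomain f (pairExp p q) = pairExp (f p) (f q) := by
  simp [pairExp, Finsupp.mapDomain_add, Finsupp.mapDomain_single]

/-- The monomial `y^a` is not divisible by the leading monomial of a quadratic binomial of the
toric ideal of `A`. -/
def IsQuadraticallyReduced (A : Set (σ →₀ ℕ)) (m : MonomialOrder.{u, u} A) (a : A →₀ ℕ) : Prop :=
  ∀ p q r s : A, pairExp p q ≤ a → (p : σ →₀ ℕ) + q = (r : σ →₀ ℕ) + s →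
    m.toSyn (pairExp p q) ≤ m.toSyn (pairExp r s)

variable (K : Type v) [Field K]

theorem toricHom_monomial (A : Set (σ →₀ ℕ)) (a : A →₀ ℕ) (c : K) :
    toricHom K A (monomial a c) = monomial (toricDegree A a) c := by
  rw [toricHom, aeval_monomial, toricDegree]
  simp only [monomial_pow, one_pow, algebraMap_eq]
  rw [LinearMap.toAddMonoidHom_coe, Finsupp.linearCombination_apply, Finsupp.sum, monomial_sum_index,
    Finsupp.prod]

theorem monomial_pairExp (p q : τ) : monomial (pairExp p q) (1 : K) = X p * X q := by
  rw [pairExp, X, X, monomial_mul, one_mul]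

theorem monomial_sub_mem_toricIdeal_iff (A : Set (σ →₀ ℕ)) (a b : A →₀ ℕ) :
    monomial a (1 : K) - monomial b 1 ∈ toricIdeal K A ↔ toricDegree A a = toricDegree A b := by
  rw [toricIdeal, RingHom.mem_ker]
  simp only [map_sub, toricHom_monomial, sub_eq_zero]
  exact (monomial_left_injective one_ne_zero).eq_iff

/-- The coefficients in each fibre sum to zero, so a term alone in its fibre could not cancel. -/
theorem exists_ne_mem_support_of_mem_toricIdeal (A : Set (σ →₀ ℕ)) {f : MvPolynomial A K}
    (hf : f ∈ toricIdeal K A) {a : A →₀ ℕ} (ha : a ∈ f.support) :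
    ∃ b ∈ f.support, b ≠ a ∧ toricDegree A b = toricDegree A a := by
  classical
  by_contra! h
  have h0 : toricHom K A f = 0 := hf
  have h1 : coeff (toricDegree A a) (toricHom K A f) = coeff a f := by
    conv_lhs => rw [f.as_sum]
    rw [map_sum, coeff_sum, Finset.sum_eq_single a]
    · rw [toricHom_monomial, coeff_monomial, if_pos rfl]
    · intro b hb hba
      rw [toricHom_monomial, coeff_monomial, if_neg (h b hb hba)]
    · exact fun h' => absurd ha h'
  rw [h0, coeff_zero] at h1
  exact mem_support_iff.1 ha h1.symm

variable {K}

theorem degree_monomial_sub_monomial (m : MonomialOrder τ) {a b : τ →₀ ℕ}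
    (h : m.toSyn b < m.toSyn a) : m.degree (monomial a (1 : K) - monomial b 1) = a := by
  classical
  rw [m.degree_sub_of_lt, m.degree_monomial, if_neg one_ne_zero]
  simpa [m.degree_monomial] using h

theorem eq_pairExp_of_isQuadraticBinomial (m : MonomialOrder.{u, u} τ) {g : MvPolynomial τ K}
    (hg : IsQuadraticBinomial g) :
    ∃ p q r s : τ, m.degree g = pairExp p q ∧ m.toSyn (pairExp r s) < m.toSyn (pairExp p q) ∧
      (g = monomial (pairExp p q) 1 - monomial (pairExp r s) 1 ∨
        g = -(monomial (pairExp p q) 1 - monomial (pairExp r s) 1)) := by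
  obtain ⟨h0, a, b, c, d, rfl⟩ := hg
  rw [← monomial_pairExp, ← monomial_pairExp] at *
  rcases lt_trichotomy (m.toSyn (pairExp a b)) (m.toSyn (pairExp c d)) with h | h | h
  · refine ⟨c, d, a, b, ?_, h, Or.inr (neg_sub _ _).symm⟩
    rw [← neg_sub, m.degree_neg, degree_monomial_sub_monomial m h]
  · rw [m.toSyn.injective h, sub_self] at h0
    exact absurd rfl h0
  · exact ⟨a, b, c, d, degree_monomial_sub_monomial m h, h, Or.inl rfl⟩

theorem span_leadingTerm_eq (m : MonomialOrder τ) (G : Set (MvPolynomial τ K))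
    (hG : (0 : MvPolynomial τ K) ∉ G) : Ideal.span (m.leadingTerm '' G) =
      Ideal.span ((fun s => monomial s (1 : K)) '' (m.degree '' G)) := by
  rw [Set.image_image]
  refine m.span_leadingTerm_eq_span_monomial fun g hg => ?_
  rw [isUnit_iff_ne_zero, Ne, m.leadingCoeff_eq_zero_iff]
  rintro rfl
  exact hG hg

/-- The toric ideal of `A` has a quadratic Gröbner basis iff, for some term order, distinct monomials
that are not divisible by leading monomials of quadratic binomials have distinct images. -/
theorem hasQuadraticGroebnerBasis_toricIdeal_iff (A : Set (σ →₀ ℕ)) (hA : A.Finite) :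
    HasQuadraticGroebnerBasis (toricIdeal K A) ↔ ∃ m : MonomialOrder.{u, u} A,
      ∀ a b, IsQuadraticallyReduced A m a → IsQuadraticallyReduced A m b →
        toricDegree A a = toricDegree A b → a = b := by
  classical
  constructor
  · rintro ⟨m, G, ⟨-, hGI, hG0, hspan⟩, hG⟩
    refine ⟨m, ?_⟩
    -- Reduced monomials are minimal in their fibre: otherwise `a` would lead a binomial of the
    -- ideal and be divisible by the leading monomial of some element of `G`.
    have key : ∀ a b, IsQuadraticallyReduced A m a → toricDegree A a = toricDegree A b →
        ¬ m.toSyn b < m.toSyn a := by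
      intro a b ha hab hlt
      have hmem : monomial a (1 : K) ∈ Ideal.span (m.leadingTerm '' G) := by
        rw [hspan]
        refine Ideal.subset_span ⟨_, (monomial_sub_mem_toricIdeal_iff K A a b).2 hab, ?_⟩
        have hd := degree_monomial_sub_monomial (K := K) m hlt
        rw [MonomialOrder.leadingTerm, MonomialOrder.leadingCoeff, hd, coeff_sub,
          coeff_monomial, coeff_monomial, if_pos rfl, if_neg, sub_zero]
        rintro rfl
        exact lt_irrefl _ hlt
      rw [span_leadingTerm_eq m G hG0, mem_ideal_span_monomial_image] at hmem
      obtain ⟨_, ⟨g, hg, rfl⟩, hle⟩ := hmem a (by simp [coeff_monomial])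
      obtain ⟨p, q, r, s, hd, hrs, hgeq⟩ := eq_pairExp_of_isQuadraticBinomial m (hG g hg)
      have hI : monomial (pairExp p q) (1 : K) - monomial (pairExp r s) 1 ∈ toricIdeal K A := by
        rcases hgeq with h | h
        · exact h ▸ hGI hg
        · exact neg_mem_iff.1 (h ▸ hGI hg)
      rw [monomial_sub_mem_toricIdeal_iff, toricDegree_pairExp, toricDegree_pairExp] at hI
      exact (ha p q r s (hd ▸ hle) hI).not_gt hrs
    intro a b ha hb hab
    exact m.toSyn.injective (le_antisymm (not_lt.1 (key a b ha hab))
      (not_lt.1 (key b a hb hab.symm)))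
  · rintro ⟨m, hm⟩
    have : Finite A := hA
    set G : Set (MvPolynomial A K) := {g | g ∈ toricIdeal K A ∧ IsQuadraticBinomial g} with hGdef
    have hG0 : (0 : MvPolynomial A K) ∉ G := fun h => h.2.1 rfl
    refine ⟨m, G, ⟨?_, fun g hg => hg.1, hG0, ?_⟩, fun g hg => hg.2⟩
    · refine (Set.finite_range fun x : A × A × A × A =>
        (X x.1 * X x.2.1 - X x.2.2.1 * X x.2.2.2 : MvPolynomial A K)).subset ?_
      rintro _ ⟨-, -, a, b, c, d, rfl⟩
      exact ⟨(a, b, c, d), rfl⟩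
    · refine le_antisymm (Ideal.span_mono (Set.image_mono fun g hg => hg.1)) (Ideal.span_le.2 ?_)
      rintro _ ⟨f, hf, rfl⟩
      by_cases hf0 : f = 0
      · simp [hf0]
      have hsupp := (m.degree_mem_support_iff f).2 hf0
      obtain ⟨b, hb, hba, hdeg⟩ := exists_ne_mem_support_of_mem_toricIdeal K A hf hsupp
      have hlt : m.toSyn b < m.toSyn (m.degree f) :=
        lt_of_le_of_ne (m.le_degree hb) (fun h => hba (m.toSyn.injective h))
      -- the minimal monomial in the fibre is reduced
      obtain ⟨c, hc, hcmin⟩ := (InvImage.wf m.toSyn (wellFounded_lt (α := m.syn))).has_min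
        {c | toricDegree A c = toricDegree A b} ⟨b, rfl⟩
      have hcred : IsQuadraticallyReduced A m c := by
        intro p q r s hle hpq
        obtain ⟨e, rfl⟩ := exists_add_of_le hle
        have h1 : toricDegree A (pairExp r s + e) = toricDegree A b := by
          rw [← show _ = toricDegree A b from hc, map_add, map_add, toricDegree_pairExp,
            toricDegree_pairExp, hpq]
        have h2 := not_lt.1 (hcmin _ h1)
        rw [map_add, map_add] at h2
        exact le_of_add_le_add_right h2
      -- If reduced, the leading monomial would be the fibre minimum `c`, yet `b` lies strictly
      -- below it in the same fibre.
      have hred : ¬ IsQuadraticallyReduced A m (m.degree f) := by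
        intro h
        have := hm _ _ h hcred (hdeg.symm.trans (show _ = toricDegree A b from hc).symm)
        rw [this] at hlt
        exact hcmin b rfl hlt
      simp only [IsQuadraticallyReduced, not_forall, not_le] at hred
      obtain ⟨p, q, r, s, hle, hpq, hrs⟩ := hred
      rw [SetLike.mem_coe, span_leadingTerm_eq m G hG0, mem_ideal_span_monomial_image]
      intro x hx
      rw [m.support_leadingTerm' hf0, Finset.mem_singleton] at hx
      rw [hx]
      refine ⟨_, ⟨monomial (pairExp p q) 1 - monomial (pairExp r s) 1, ⟨?_, ?_⟩, rfl⟩, ?_⟩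
      · rwa [monomial_sub_mem_toricIdeal_iff, toricDegree_pairExp, toricDegree_pairExp]
      · refine ⟨fun h => ?_, p, q, r, s, by rw [monomial_pairExp, monomial_pairExp]⟩
        have := monomial_left_injective one_ne_zero (sub_eq_zero.1 h)
        exact hrs.ne (congrArg m.toSyn this.symm)
      · rwa [degree_monomial_sub_monomial m hrs]

/-! ### Lifting divisors along a map of variables -/

theorem exists_single_le_of_single_le_mapDomain {ρ : Type*} (f : τ → ρ) {b : ρ} {x : τ →₀ ℕ}
    (h : Finsupp.single b 1 ≤ Finsupp.mapDomain f x) : ∃ a, f a = b ∧ Finsupp.single a 1 ≤ x := by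
  classical
  have hb : b ∈ (Finsupp.mapDomain f x).support := by
    rw [Finsupp.single_le_iff] at h
    rw [Finsupp.mem_support_iff]
    omega
  obtain ⟨a, ha, rfl⟩ := Finset.mem_image.1 (Finsupp.mapDomain_support hb)
  refine ⟨a, rfl, ?_⟩
  rw [Finsupp.single_le_iff]
  exact Nat.one_le_iff_ne_zero.2 (Finsupp.mem_support_iff.1 ha)

/-- A vector below the image of `x` under `mapDomain` lifts to a vector below `x`. -/
theorem exists_le_mapDomain_eq {ρ : Type*} (f : τ → ρ) (r : ρ →₀ ℕ) (x : τ →₀ ℕ)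
    (h : r ≤ Finsupp.mapDomain f x) : ∃ y ≤ x, Finsupp.mapDomain f y = r := by
  classical
  have add : ∀ r₁ r₂ : ρ →₀ ℕ,
      (∀ x, r₁ ≤ Finsupp.mapDomain f x → ∃ y ≤ x, Finsupp.mapDomain f y = r₁) →
      (∀ x, r₂ ≤ Finsupp.mapDomain f x → ∃ y ≤ x, Finsupp.mapDomain f y = r₂) →
      ∀ x, r₁ + r₂ ≤ Finsupp.mapDomain f x → ∃ y ≤ x, Finsupp.mapDomain f y = r₁ + r₂ := by
    intro r₁ r₂ h₁ h₂ x hx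
    obtain ⟨y₁, hy₁, rfl⟩ := h₁ x (le_self_add.trans hx)
    obtain ⟨z, rfl⟩ := exists_add_of_le hy₁
    rw [Finsupp.mapDomain_add] at hx
    obtain ⟨y₂, hy₂, rfl⟩ := h₂ z (le_of_add_le_add_left hx)
    exact ⟨y₁ + y₂, add_le_add_right hy₂ y₁, Finsupp.mapDomain_add⟩
  have zero : ∀ x : τ →₀ ℕ, (0 : ρ →₀ ℕ) ≤ Finsupp.mapDomain f x →
      ∃ y ≤ x, Finsupp.mapDomain f y = 0 :=
    fun x _ => ⟨0, zero_le, Finsupp.mapDomain_zero⟩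
  induction r using Finsupp.induction_linear generalizing x with
  | zero => exact zero x h
  | add r₁ r₂ h₁ h₂ => exact add r₁ r₂ h₁ h₂ x h
  | single b k =>
    induction k generalizing x with
    | zero => rw [Finsupp.single_zero] at h ⊢; exact zero x h
    | succ k ih =>
      rw [Finsupp.single_add] at h ⊢
      refine add _ _ ih (fun x hx => ?_) x h
      obtain ⟨a, rfl, ha⟩ := exists_single_le_of_single_le_mapDomain f hx
      exact ⟨Finsupp.single a 1, ha, Finsupp.mapDomain_single⟩

theorem exists_pairExp_le_of_le_mapDomain {ρ : Type*} (f : τ → ρ) {p q : ρ} {x : τ →₀ ℕ}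
    (h : pairExp p q ≤ Finsupp.mapDomain f x) :
    ∃ p' q', f p' = p ∧ f q' = q ∧ pairExp p' q' ≤ x := by
  obtain ⟨p', rfl, hp⟩ := exists_single_le_of_single_le_mapDomain f (le_self_add.trans h)
  obtain ⟨z, rfl⟩ := exists_add_of_le hp
  rw [Finsupp.mapDomain_add, Finsupp.mapDomain_single] at h
  obtain ⟨q', rfl, hq⟩ := exists_single_le_of_single_le_mapDomain f (le_of_add_le_add_left h)
  exact ⟨p', q', rfl, rfl, add_le_add_right hq _⟩

end Rewriting

/-! ### The expansion as a preimage under block sums -/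

section BlockSums

variable {n : ℕ} {α : Fin n → ℕ}

theorem mapDomain_sigma_fst_apply (w : (Σ i, Fin (α i)) →₀ ℕ) (i : Fin n) :
    Finsupp.mapDomain Sigma.fst w i = ∑ j, w ⟨i, j⟩ := by
  classical
  rw [Finsupp.mapDomain, Finsupp.sum_fintype _ _ (by simp), Finsupp.finsetSum_apply,
    ← Finset.univ_sigma_univ, Finset.sum_sigma, Finset.sum_eq_single i]
  · simp
  · intro i' _ h
    simp [h]
  · simp

theorem mem_expansion_iff_mapDomain_mem (K : Type v) [Field K] (A : Set (Fin n →₀ ℕ))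
    (w : (Σ i, Fin (α i)) →₀ ℕ) :
    w ∈ expansion K α A ↔ Finsupp.mapDomain Sigma.fst w ∈ A := by
  rw [mem_expansion_iff]
  simp only [← mapDomain_sigma_fst_apply, ← Finsupp.ext_iff]
  simp

variable {A : Set (Fin n →₀ ℕ)} {B : Set ((Σ i, Fin (α i)) →₀ ℕ)}

theorem finite_of_mapDomain_mem (hB : ∀ w, w ∈ B ↔ Finsupp.mapDomain Sigma.fst w ∈ A)
    (hA : A.Finite) : B.Finite := by
  classical
  refine (hA.biUnion fun u _ => Set.finite_Iic
    (Finsupp.equivFunOnFinite.symm fun x : Σ i, Fin (α i) => u x.1)).subset fun w hw => ?_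
  refine Set.mem_biUnion ((hB w).1 hw) fun x => ?_
  rw [Finsupp.coe_equivFunOnFinite_symm, mapDomain_sigma_fst_apply]
  exact Finset.single_le_sum (f := fun j => w ⟨x.1, j⟩) (fun _ _ => Nat.zero_le _)
    (Finset.mem_univ x.2)

/-- The map `B → A` induced by `x_{ij} ↦ x_i`. -/
noncomputable def blockMap (hB : ∀ w, w ∈ B ↔ Finsupp.mapDomain Sigma.fst w ∈ A) (w : B) : A :=
  ⟨Finsupp.mapDomain Sigma.fst (w : (Σ i, Fin (α i)) →₀ ℕ), (hB w).1 w.2⟩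

theorem toricDegree_mapDomain_blockMap
    (hB : ∀ w, w ∈ B ↔ Finsupp.mapDomain Sigma.fst w ∈ A) (a : B →₀ ℕ) :
    toricDegree A (Finsupp.mapDomain (blockMap hB) a) =
      Finsupp.mapDomain Sigma.fst (toricDegree B a) := by
  induction a using Finsupp.induction_linear with
  | zero => simp
  | add a b ha hb => simp only [Finsupp.mapDomain_add, map_add, ha, hb]
  | single w k =>
    rw [Finsupp.mapDomain_single, toricDegree_single, toricDegree_single, Finsupp.mapDomain_smul]
    rfl

/-! ### Sorted monomials -/

/-- If `T w ≤ T w'` and `y_w y_{w'}` divides `y^a`, then in each block the variables of `w` come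
before those of `w'`. -/
def IsSortedBy (T : B → ℕ) (a : B →₀ ℕ) : Prop :=
  ∀ w w' : B, pairExp w w' ≤ a → T w ≤ T w' → ∀ (i : Fin n) (j j' : Fin (α i)), j < j' →
    (w : (Σ i, Fin (α i)) →₀ ℕ) ⟨i, j'⟩ = 0 ∨ (w' : (Σ i, Fin (α i)) →₀ ℕ) ⟨i, j⟩ = 0

theorem IsSortedBy.mono {T : B → ℕ} {a b : B →₀ ℕ} (h : IsSortedBy T a) (hb : b ≤ a) :
    IsSortedBy T b :=
  fun w w' hw => h w w' (hw.trans hb)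

/-- Once the factor of least `T` uses a later variable of a block, sortedness bars the earlier ones
from all other factors, so it carries their whole exponent. -/
theorem IsSortedBy.toricDegree_apply {T : B → ℕ} {w : B} {a : B →₀ ℕ}
    (h : IsSortedBy T (Finsupp.single w 1 + a)) (hw : ∀ w' ∈ a.support, T w ≤ T w')
    {i : Fin n} {j j' : Fin (α i)} (hj : j < j') (h0 : (w : (Σ i, Fin (α i)) →₀ ℕ) ⟨i, j'⟩ ≠ 0) :
    toricDegree B (Finsupp.single w 1 + a) ⟨i, j⟩ = (w : (Σ i, Fin (α i)) →₀ ℕ) ⟨i, j⟩ := by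
  have ha : toricDegree B a ⟨i, j⟩ = 0 := by
    change Finsupp.linearCombination ℕ (fun u : B => (u : (Σ i, Fin (α i)) →₀ ℕ)) a ⟨i, j⟩ = 0
    rw [Finsupp.linearCombination_apply, Finsupp.sum, Finsupp.finsetSum_apply]
    refine Finset.sum_eq_zero fun w' hw' => ?_
    have hle : pairExp w w' ≤ Finsupp.single w 1 + a := by
      refine add_le_add_right ?_ _
      rw [Finsupp.single_le_iff]
      exact Nat.one_le_iff_ne_zero.2 (Finsupp.mem_support_iff.1 hw')
    have := (h w w' hle (hw w' hw') i j j' hj).resolve_left h0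
    rw [Finsupp.smul_apply, this, smul_zero]
  rw [map_add, Finsupp.add_apply, ha, toricDegree_single, one_smul, add_zero]

theorem apply_le_toricDegree_apply (w : B) (a : B →₀ ℕ) (x : Σ i, Fin (α i)) :
    (w : (Σ i, Fin (α i)) →₀ ℕ) x ≤ toricDegree B (Finsupp.single w 1 + a) x := by
  rw [map_add, Finsupp.add_apply, toricDegree_single, one_smul]
  exact Nat.le_add_right _ _

theorem exists_eq_single_add_of_ne_zero (T : B → ℕ) {a : B →₀ ℕ} (ha : a ≠ 0) :
    ∃ w a', a = Finsupp.single w 1 + a' ∧ ∀ w' ∈ a.support, T w ≤ T w' := by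
  obtain ⟨w, hw, hmin⟩ := a.support.exists_min_image T (Finsupp.support_nonempty_iff.2 ha)
  have hle : Finsupp.single w 1 ≤ a := by
    rw [Finsupp.single_le_iff]
    exact Nat.one_le_iff_ne_zero.2 (Finsupp.mem_support_iff.1 hw)
  obtain ⟨a', ha'⟩ := exists_add_of_le hle
  exact ⟨w, a', ha', hmin⟩

theorem support_subset_support_add (a b : B →₀ ℕ) : b.support ⊆ (a + b).support := by
  intro x hx
  rw [Finsupp.mem_support_iff] at *
  rw [Finsupp.add_apply]
  omega

/-- A sorted monomial is determined by its image and the multiset of its block sums. -/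
theorem IsSortedBy.eq_of_toricDegree_eq (hB : ∀ w, w ∈ B ↔ Finsupp.mapDomain Sigma.fst w ∈ A)
    {T : B → ℕ} {ω : A → ℕ} (hω : Function.Injective ω)
    (hT : ∀ w w', T w ≤ T w' → ω (blockMap hB w) ≤ ω (blockMap hB w')) {a b : B →₀ ℕ}
    (ha : IsSortedBy T a) (hb : IsSortedBy T b)
    (hmap : Finsupp.mapDomain (blockMap hB) a = Finsupp.mapDomain (blockMap hB) b)
    (hdeg : toricDegree B a = toricDegree B b) : a = b := by
  classical
  induction hN : a.degree generalizing a b with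
  | zero =>
    rw [Finsupp.degree_eq_zero_iff] at hN
    subst hN
    rw [Finsupp.mapDomain_zero] at hmap
    by_contra hb0
    obtain ⟨w, b', rfl, -⟩ := exists_eq_single_add_of_ne_zero T (Ne.symm hb0)
    have := DFunLike.congr_fun hmap (blockMap hB w)
    rw [Finsupp.mapDomain_add, Finsupp.mapDomain_single] at this
    simp only [Finsupp.coe_zero, Pi.zero_apply, Finsupp.add_apply, Finsupp.single_eq_same] at this
    omega
  | succ N ih =>
    have ha0 : a ≠ 0 := by rintro rfl; simp at hN
    have hb0 : b ≠ 0 := by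
      rintro rfl
      obtain ⟨w, a', rfl, -⟩ := exists_eq_single_add_of_ne_zero T ha0
      have := DFunLike.congr_fun hmap (blockMap hB w)
      rw [Finsupp.mapDomain_add, Finsupp.mapDomain_single] at this
      simp at this
    obtain ⟨w, a', rfl, hwmin⟩ := exists_eq_single_add_of_ne_zero T ha0
    obtain ⟨w₀, b', rfl, hw₀min⟩ := exists_eq_single_add_of_ne_zero T hb0
    -- Equal images make every block-sum vector of one product occur in the other; used both ways,
    -- this gives the two `T`-minimal factors the same block sums.
    have aux : ∀ {v v₀ : B} {a b : B →₀ ℕ}, (∀ w' ∈ b.support, T v₀ ≤ T w') →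
        Finsupp.mapDomain (blockMap hB) (Finsupp.single v 1 + a) =
          Finsupp.mapDomain (blockMap hB) b → ω (blockMap hB v₀) ≤ ω (blockMap hB v) := by
      intro v v₀ a b hmin h
      have : Finsupp.single (blockMap hB v) 1 ≤ Finsupp.mapDomain (blockMap hB) b := by
        rw [← h, Finsupp.mapDomain_add, Finsupp.mapDomain_single]
        exact le_self_add
      obtain ⟨v', hv', hle⟩ := exists_single_le_of_single_le_mapDomain _ this
      rw [← hv']
      refine hT _ _ (hmin v' ?_)
      rw [Finsupp.single_le_iff] at hle
      rw [Finsupp.mem_support_iff]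
      omega
    have hπ : blockMap hB w = blockMap hB w₀ :=
      hω (le_antisymm (aux hwmin hmap.symm) (aux hw₀min hmap))
    have hrow : ∀ i, ∑ j, (w : (Σ i, Fin (α i)) →₀ ℕ) ⟨i, j⟩ =
        ∑ j, (w₀ : (Σ i, Fin (α i)) →₀ ℕ) ⟨i, j⟩ := by
      intro i
      rw [← mapDomain_sigma_fst_apply, ← mapDomain_sigma_fst_apply]
      exact DFunLike.congr_fun (congrArg Subtype.val hπ) i
    have hamin := fun w' hw' => hwmin w' (support_subset_support_add _ _ hw')
    have hbmin := fun w' hw' => hw₀min w' (support_subset_support_add _ _ hw')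
    have hww : w = w₀ := by
      refine Subtype.ext (Finsupp.ext ?_)
      rintro ⟨i, j₀⟩
      by_contra hne
      have hlt : ∃ j, (w : (Σ i, Fin (α i)) →₀ ℕ) ⟨i, j⟩ <
          (w₀ : (Σ i, Fin (α i)) →₀ ℕ) ⟨i, j⟩ := by
        by_contra! h
        exact hne ((Finset.sum_eq_sum_iff_of_le fun j _ => h j).1 (hrow i).symm j₀
          (Finset.mem_univ _)).symm
      have hgt : ∃ j, (w₀ : (Σ i, Fin (α i)) →₀ ℕ) ⟨i, j⟩ <
          (w : (Σ i, Fin (α i)) →₀ ℕ) ⟨i, j⟩ := by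
        by_contra! h
        exact hne ((Finset.sum_eq_sum_iff_of_le fun j _ => h j).1 (hrow i) j₀ (Finset.mem_univ _))
      obtain ⟨j, hj⟩ := hlt
      obtain ⟨j', hj'⟩ := hgt
      rcases lt_trichotomy j j' with h | h | h
      -- Here `w` uses `x_{ij'}`, so the total exponent of `x_{ij}` is that of `w` alone, which is
      -- less than what `w₀` already contributes.
      · have h1 := ha.toricDegree_apply hamin h (by omega)
        have h2 := apply_le_toricDegree_apply w₀ b' ⟨i, j⟩
        rw [hdeg] at h1
        omega
      · subst h
        omega
      · have h1 := hb.toricDegree_apply hbmin h (by omega)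
        have h2 := apply_le_toricDegree_apply w a' ⟨i, j'⟩
        rw [hdeg] at h2
        omega
    subst hww
    rw [Finsupp.mapDomain_add, Finsupp.mapDomain_add] at hmap
    rw [map_add, map_add] at hdeg
    rw [map_add, Finsupp.degree_single] at hN
    rw [ih (ha.mono le_add_self) (hb.mono le_add_self) (add_left_cancel hmap)
      (add_left_cancel hdeg) (by omega)]

/-! ### Lifting a term order to the expansion -/

/-- The homomorphism defining the term order on `τ` that compares first the images under `π` with
respect to `m`, then the weights `c`, with ties broken by `m₀`. -/
noncomputable def liftedOrderHom {τ ρ : Type u} (π : τ → ρ) (m : MonomialOrder.{u, u} ρ)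
    (c : τ → ℕ) (m₀ : MonomialOrder.{u, u} τ) : (τ →₀ ℕ) →+ m.syn ×ₗ (ℕ ×ₗ m₀.syn) where
  toFun a := toLex (m.toSyn (Finsupp.mapDomain π a), toLex (Finsupp.weight c a, m₀.toSyn a))
  map_zero' := by simp only [Finsupp.mapDomain_zero, map_zero]; rfl
  map_add' a b := by simp only [Finsupp.mapDomain_add, map_add]; rfl

theorem liftedOrderHom_injective {τ ρ : Type u} (π : τ → ρ) (m : MonomialOrder.{u, u} ρ)
    (c : τ → ℕ) (m₀ : MonomialOrder.{u, u} τ) :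
    Function.Injective (liftedOrderHom π m c m₀) :=
  fun _ _ h => m₀.toSyn.injective (congrArg (fun x => (ofLex (ofLex x).2).2) h)

theorem liftedOrderHom_monotone {τ ρ : Type u} (π : τ → ρ) (m : MonomialOrder.{u, u} ρ)
    (c : τ → ℕ) (m₀ : MonomialOrder.{u, u} τ) :
    Monotone (liftedOrderHom π m c m₀) := by
  intro a b hab
  obtain ⟨d, rfl⟩ := exists_add_of_le hab
  refine Prod.Lex.toLex_mono ⟨?_, Prod.Lex.toLex_mono ⟨?_, m₀.toSyn_monotone hab⟩⟩
  · rw [Finsupp.mapDomain_add]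
    exact m.toSyn_monotone le_self_add
  · simp only [map_add]
    exact Nat.le_add_right _ _

theorem exists_reduced_unique_of_blockMap
    (hB : ∀ w, w ∈ B ↔ Finsupp.mapDomain Sigma.fst w ∈ A) (hA : A.Finite)
    (m : MonomialOrder.{0, 0} A)
    (hm : ∀ a b, IsQuadraticallyReduced A m a → IsQuadraticallyReduced A m b →
        toricDegree A a = toricDegree A b → a = b) :
    ∃ m' : MonomialOrder.{0, 0} B,
      ∀ a b, IsQuadraticallyReduced B m' a → IsQuadraticallyReduced B m' b →
        toricDegree B a = toricDegree B b → a = b := by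
  have : Finite A := hA
  have : Finite B := finite_of_mapDomain_mem hB hA
  obtain ⟨m₀⟩ := MonomialOrder.nonempty_of_finite B
  obtain ⟨ω, hω⟩ := Countable.exists_injective_nat A
  let s : ((Σ i, Fin (α i)) →₀ ℕ) →+ ℕ := Finsupp.weight fun x => (x.2 : ℕ)
  obtain ⟨C, hC⟩ := (Set.finite_range fun w : B => s w).bddAbove
  have hC : ∀ w : B, s w ≤ C := fun w => hC ⟨w, rfl⟩
  -- The factor `C + 1` exceeds every value of `s`, so `T` orders by `ω` of the block sums first and
  -- by column position second.
  let T : B → ℕ := fun w => s w + (C + 1) * ω (blockMap hB w)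
  have hT : ∀ w w', T w ≤ T w' → ω (blockMap hB w) ≤ ω (blockMap hB w') := by
    intro w w' h
    by_contra! hlt
    have h1 : (C + 1) * (ω (blockMap hB w') + 1) ≤ (C + 1) * ω (blockMap hB w) :=
      Nat.mul_le_mul_left _ hlt
    have h2 := hC w'
    simp only [T] at h
    rw [mul_add] at h1
    omega
  -- The bound `M` keeps the truncated subtraction in the weight `M - T w ^ 2` exact.
  obtain ⟨M, hM⟩ := (Set.finite_range fun w : B => T w ^ 2).bddAbove
  have hM : ∀ w : B, T w ^ 2 ≤ M := fun w => hM ⟨w, rfl⟩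
  let f := liftedOrderHom (blockMap hB) m (fun w => M - T w ^ 2) m₀
  have hf : ∀ p q r s : B, f (pairExp p q) ≤ f (pairExp r s) →
      m.toSyn (pairExp (blockMap hB p) (blockMap hB q)) ≤
        m.toSyn (pairExp (blockMap hB r) (blockMap hB s)) ∧
      (blockMap hB p = blockMap hB r → blockMap hB q = blockMap hB s →
        T r ^ 2 + T s ^ 2 ≤ T p ^ 2 + T q ^ 2) := by
    intro p q r s h
    rw [← mapDomain_pairExp, ← mapDomain_pairExp]
    have h := Prod.Lex.toLex_le_toLex'.1 h
    refine ⟨h.1, fun hpr hqs => ?_⟩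
    have h2 := (Prod.Lex.toLex_le_toLex'.1 (h.2 (by
      simp only [mapDomain_pairExp, hpr, hqs]))).1
    simp only [pairExp, map_add, Finsupp.weight_single, one_smul] at h2
    have := hM p
    have := hM q
    have := hM r
    have := hM s
    omega
  refine ⟨MonomialOrder.ofInjective f (liftedOrderHom_injective _ _ _ _)
    (liftedOrderHom_monotone _ _ _ _), ?_⟩
  have hproj : ∀ a, IsQuadraticallyReduced B (MonomialOrder.ofInjective f
      (liftedOrderHom_injective _ _ _ _) (liftedOrderHom_monotone _ _ _ _)) a →
      IsQuadraticallyReduced A m (Finsupp.mapDomain (blockMap hB) a) := by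
    intro a ha p q r t hle hpq
    obtain ⟨w, w', rfl, rfl, hw⟩ := exists_pairExp_le_of_le_mapDomain _ hle
    -- To lift the relation, split the product of `w` and `w'` into factors with block sums `r` and
    -- `t`.
    have hr : (r : Fin n →₀ ℕ) ≤ Finsupp.mapDomain Sigma.fst
        ((w : (Σ i, Fin (α i)) →₀ ℕ) + (w' : (Σ i, Fin (α i)) →₀ ℕ)) := by
      rw [Finsupp.mapDomain_add]
      exact le_self_add.trans hpq.ge
    obtain ⟨v, hv, hvr⟩ := exists_le_mapDomain_eq _ _ _ hr
    obtain ⟨v', hv'⟩ := exists_add_of_le hv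
    have hv't : Finsupp.mapDomain Sigma.fst v' = (t : Fin n →₀ ℕ) := by
      have := congrArg (Finsupp.mapDomain Sigma.fst) hv'
      rw [Finsupp.mapDomain_add, Finsupp.mapDomain_add, hvr] at this
      exact add_left_cancel (this.symm.trans hpq)
    have hvB : v ∈ B := (hB v).2 (hvr ▸ r.2)
    have hv'B : v' ∈ B := (hB v').2 (hv't ▸ t.2)
    have h := (hf _ _ _ _ (ha w w' ⟨v, hvB⟩ ⟨v', hv'B⟩ hw hv')).1
    rwa [show blockMap hB ⟨v, hvB⟩ = r from Subtype.ext hvr,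
      show blockMap hB ⟨v', hv'B⟩ = t from Subtype.ext hv't] at h
  have hsort : ∀ a, IsQuadraticallyReduced B (MonomialOrder.ofInjective f
      (liftedOrderHom_injective _ _ _ _) (liftedOrderHom_monotone _ _ _ _)) a →
      IsSortedBy T a := by
    intro a ha w w' hle hTw i j j' hj
    -- Otherwise exchange `x_{ij'}` in `w` with `x_{ij}` in `w'`; block sums and product are
    -- unchanged.
    by_contra! h
    have hw : Finsupp.single ⟨i, j'⟩ 1 ≤ (w : (Σ i, Fin (α i)) →₀ ℕ) := by
      rw [Finsupp.single_le_iff]; omega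
    have hw' : Finsupp.single ⟨i, j⟩ 1 ≤ (w' : (Σ i, Fin (α i)) →₀ ℕ) := by
      rw [Finsupp.single_le_iff]; omega
    obtain ⟨z, hz⟩ := exists_add_of_le hw
    obtain ⟨z', hz'⟩ := exists_add_of_le hw'
    have e₁ : Finsupp.mapDomain Sigma.fst (Finsupp.single (⟨i, j⟩ : Σ i, Fin (α i)) 1 + z) =
        Finsupp.mapDomain Sigma.fst (w : (Σ i, Fin (α i)) →₀ ℕ) := by
      rw [hz, Finsupp.mapDomain_add, Finsupp.mapDomain_add, Finsupp.mapDomain_single,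
        Finsupp.mapDomain_single]
    have e₂ : Finsupp.mapDomain Sigma.fst (Finsupp.single (⟨i, j'⟩ : Σ i, Fin (α i)) 1 + z') =
        Finsupp.mapDomain Sigma.fst (w' : (Σ i, Fin (α i)) →₀ ℕ) := by
      rw [hz', Finsupp.mapDomain_add, Finsupp.mapDomain_add, Finsupp.mapDomain_single,
        Finsupp.mapDomain_single]
    obtain ⟨v, hv⟩ : ∃ v : B, (v : (Σ i, Fin (α i)) →₀ ℕ) = Finsupp.single ⟨i, j⟩ 1 + z :=
      ⟨⟨_, (hB _).2 (e₁ ▸ (hB _).1 w.2)⟩, rfl⟩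
    obtain ⟨v', hv'⟩ : ∃ v : B, (v : (Σ i, Fin (α i)) →₀ ℕ) = Finsupp.single ⟨i, j'⟩ 1 + z' :=
      ⟨⟨_, (hB _).2 (e₂ ▸ (hB _).1 w'.2)⟩, rfl⟩
    have hπ : blockMap hB w = blockMap hB v := Subtype.ext (by
      rw [← hv] at e₁; exact e₁.symm)
    have hπ' : blockMap hB w' = blockMap hB v' := Subtype.ext (by
      rw [← hv'] at e₂; exact e₂.symm)
    have hsum : (w : (Σ i, Fin (α i)) →₀ ℕ) + w' = v + v' := by
      rw [hz, hz', hv, hv']; abel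
    have hle2 := (hf _ _ _ _ (ha w w' v v' hle hsum)).2 hπ hπ'
    have hTv : T v + j' = T w + j := by
      simp only [T, hπ, hv, hz, map_add, s, Finsupp.weight_single, one_smul]
      omega
    have hTv' : T v' + j = T w' + j' := by
      simp only [T, hπ', hv', hz', map_add, s, Finsupp.weight_single, one_smul]
      omega
    obtain ⟨d, hd⟩ := Nat.exists_eq_add_of_lt (Fin.lt_def.1 hj)
    have h1 : T w = T v + (d + 1) := by omega
    have h2 : T v' = T w' + (d + 1) := by omega
    rw [h1] at hTw
    rw [h1, h2] at hle2
    -- The swap pushes the smaller label down and the larger one up by `d + 1`, strictly raising the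
    -- sum of squares.
    nlinarith
  intro a b ha hb hab
  refine (hsort a ha).eq_of_toricDegree_eq hB hω hT (hsort b hb) ?_ hab
  refine hm _ _ (hproj a ha) (hproj b hb) ?_
  rw [toricDegree_mapDomain_blockMap, toricDegree_mapDomain_blockMap, hab]

/-! ### Restricting a term order to a face -/

theorem exists_reduced_unique_of_section (hα : ∀ i, 0 < α i)
    (hB : ∀ w, w ∈ B ↔ Finsupp.mapDomain Sigma.fst w ∈ A) (m : MonomialOrder.{0, 0} B)
    (hm : ∀ a b, IsQuadraticallyReduced B m a → IsQuadraticallyReduced B m b →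
        toricDegree B a = toricDegree B b → a = b) :
    ∃ m' : MonomialOrder.{0, 0} A,
      ∀ a b, IsQuadraticallyReduced A m' a → IsQuadraticallyReduced A m' b →
        toricDegree A a = toricDegree A b → a = b := by
  let e : Fin n → Σ i, Fin (α i) := fun i => ⟨i, ⟨0, hα i⟩⟩
  have hfst : ∀ u : Fin n →₀ ℕ, Finsupp.mapDomain Sigma.fst (Finsupp.mapDomain e u) = u := by
    intro u
    rw [← Finsupp.mapDomain_comp]
    exact Finsupp.mapDomain_id
  let ι : A → B := fun u => ⟨Finsupp.mapDomain e (u : Fin n →₀ ℕ), (hB _).2 (by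
    rw [hfst]; exact u.2)⟩
  have hπι : ∀ u, blockMap hB (ι u) = u := fun u => Subtype.ext (hfst u)
  have hι : Function.Injective ι := Function.LeftInverse.injective hπι
  have hιmap : Function.Injective (Finsupp.mapDomain (M := ℕ) ι) := Finsupp.mapDomain_injective hι
  let f : (A →₀ ℕ) →+ m.syn :=
    (m.toSyn : (B →₀ ℕ) →+ m.syn).comp (Finsupp.mapDomain.addMonoidHom ι)
  have hf : ∀ a, f a = m.toSyn (Finsupp.mapDomain ι a) := fun _ => rfl
  have hfi : Function.Injective f := fun a b h => hιmap (m.toSyn.injective h)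
  have hfm : Monotone f := by
    intro a b hab
    obtain ⟨d, rfl⟩ := exists_add_of_le hab
    rw [hf, hf, Finsupp.mapDomain_add]
    exact m.toSyn_monotone le_self_add
  have hdeg : ∀ a, toricDegree B (Finsupp.mapDomain ι a) =
      Finsupp.mapDomain e (toricDegree A a) := by
    intro a
    induction a using Finsupp.induction_linear with
    | zero => simp
    | add a b ha hb => simp only [Finsupp.mapDomain_add, map_add, ha, hb]
    | single w k =>
      rw [Finsupp.mapDomain_single, toricDegree_single, toricDegree_single,
        Finsupp.mapDomain_smul]
  -- The face property: a divisor of a monomial in the variables `x_{i0}` involves only those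
  -- variables.
  have hface : ∀ (u : Fin n →₀ ℕ) (r s : B), Finsupp.mapDomain e u =
      (r : (Σ i, Fin (α i)) →₀ ℕ) + (s : (Σ i, Fin (α i)) →₀ ℕ) →
      ∃ r', ι r' = r := by
    intro u r s h
    refine ⟨blockMap hB r, Subtype.ext ?_⟩
    obtain ⟨x, hx, hxr⟩ := exists_le_mapDomain_eq e (r : (Σ i, Fin (α i)) →₀ ℕ) u
      (h ▸ le_self_add)
    change Finsupp.mapDomain e (Finsupp.mapDomain Sigma.fst (r : (Σ i, Fin (α i)) →₀ ℕ)) = r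
    rw [← hxr, hfst]
  have hred : ∀ a, IsQuadraticallyReduced A (MonomialOrder.ofInjective f hfi hfm) a →
      IsQuadraticallyReduced B m (Finsupp.mapDomain ι a) := by
    intro a ha p q r s hle hpq
    obtain ⟨p, q, rfl, rfl, hle'⟩ := exists_pairExp_le_of_le_mapDomain _ hle
    have hsum : Finsupp.mapDomain e ((p : Fin n →₀ ℕ) + (q : Fin n →₀ ℕ)) =
        (r : (Σ i, Fin (α i)) →₀ ℕ) + (s : (Σ i, Fin (α i)) →₀ ℕ) := by
      rw [Finsupp.mapDomain_add]
      exact hpq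
    obtain ⟨r, rfl⟩ := hface _ r s hsum
    obtain ⟨s, rfl⟩ := hface _ s (ι r) (hsum.trans (add_comm _ _))
    have h := (MonomialOrder.ofInjective_le_iff f hfi hfm _ _).1 (ha p q r s hle' ?_)
    · rwa [hf, hf, mapDomain_pairExp, mapDomain_pairExp] at h
    · have := congrArg (Finsupp.mapDomain Sigma.fst) hpq
      rwa [Finsupp.mapDomain_add, Finsupp.mapDomain_add, hfst, hfst, hfst, hfst] at this
  refine ⟨MonomialOrder.ofInjective f hfi hfm, fun a b ha hb hab => hιmap ?_⟩
  exact hm _ _ (hred a ha) (hred b hb) (by rw [hdeg, hdeg, hab])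

end BlockSums

theorem mainTheorem12 (K : Type*) [Field K] (n : ℕ) (α : Fin n → ℕ) (hα : ∀ i, 0 < α i)
    (A : Set (Fin n →₀ ℕ)) (hA : A.Finite) :
    HasQuadraticGroebnerBasis (toricIdeal K A) ↔
      HasQuadraticGroebnerBasis (toricIdeal K (expansion K α A)) := by
  have hB := mem_expansion_iff_mapDomain_mem (α := α) K A
  rw [hasQuadraticGroebnerBasis_toricIdeal_iff A hA,
    hasQuadraticGroebnerBasis_toricIdeal_iff _ (finite_of_mapDomain_mem hB hA)]
  exact ⟨fun ⟨m, hm⟩ => exists_reduced_unique_of_blockMap hB hA m hm,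
    fun ⟨m, hm⟩ => exists_reduced_unique_of_section hα hB m hm⟩
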